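/- Let $p>3$. For a radial function $u:\mathbb R^2\to\mathbb R$, written $u(s)$ as a function of $s=|x|$, put $$h_u(r)=\frac12\int_0^r s\,u^2(s)\,ds,\qquad V_u(x)=\int_{|x|}^{+\infty}\frac{h_u(s)}{s}u^2(s)\,ds,\qquad U_u(x)=\frac{h_u^2(|x|)}{|x|^2}\ (x\ne0),\quad U_u(0)=0.$$ Let $\mathcal H^{2,4}_r(\mathbb R^2)$ be the completion of the radial functions of $C_0^\infty(\mathbb R^2)$ with respect to the norm $\|\nabla\cdot\|_2+\|\cdot\|_4$, regarded as a space of functions, let $$E(u)=\frac12\|\nabla u\|_2^2+\frac12\int_{\mathbb R^2}\frac{h_u^2(|x|)\,u^2}{|x|^2}\,dx-\frac1{p+1}\|u\|_{p+1}^{p+1},$$ and let $\mathcal H$ be the set of all $u\in\mathcal H^{2,4}_r(\mathbb R^2)$ for which $E(u)$ is finite (all three integrals converge). Let $\mathcal S$ be the set of all $u\in\mathcal H\setminus\{0\}$ that are classical solutions of $$-\Delta u+\left(\frac{h_u^2(|x|)}{|x|^2}+\int_{|x|}^{+\infty}\frac{h_u(s)}{s}u^2(s)\,ds\right)u=|u|^{p-1}u\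 \text{ in }\mathbb R^2,\qquad u(x)\to0\ \text{ as }|x|\to+\infty,$$ that is, $u$ is radial and of class $C^2$, $U_u$ and $V_u$ are well defined and continuous on $\mathbb R^2$, the equation $-\Delta u+(U_u+V_u)u=|u|^{p-1}u$ holds at every point, and $u$ vanishes at infinity. For $u\in\mathcal S$ the static quadruplet generated by $u$ is $$\phi(t,x)=u(x),\qquad A_0(t,x)=V_u(x),\qquad A_1(t,x)=-\frac{x_2}{|x|^2}h_u(|x|),\qquad A_2(t,x)=\frac{x_1}{|x|^2}h_u(|x|),$$ and the energy of a quadruplet $(\phi,A_0,A_1,A_2)$ is $$\frac12\int_{\mathbb R^2}\left(|D_1\phi|^2+|D_2\phi|^2\right)dx-\frac1{p+1}\int_{\mathbb R^2}|\phi|^{p+1}\,dx,\qquad D_j=\partial_j+iA_j.$$ Then for every $u\in\mathcal S$ the static quadruplet generated by $u$ has finite and positive energy. Moreover $$\inf_{u\in\mathcal S}E(u)>0,$$ where the infimum is taken in the extended real line. -/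

import Mathlib

open MeasureTheory Filter Topology
open scoped ContDiff ENNReal

noncomputable section

namespace CSS

/-- The plane `ℝ²` with its Euclidean norm. -/
abbrev Plane : Type := EuclideanSpace ℝ (Fin 2)

/-- The `j`-th vector of the canonical basis of the plane. -/
def basisVec (j : Fin 2) : Plane := EuclideanSpace.single j 1

/-- Radial symmetry: the value at `x` depends on `|x|` only. -/
def IsRadial (u : Plane → ℝ) : Prop := ∀ x y : Plane, ‖x‖ = ‖y‖ → u x = u y

/-- The profile of a radial function, i.e. `u` regarded as a function `u(s)` of one variable. -/
def profile (u : Plane → ℝ) (s : ℝ) : ℝ := u (s • basisVec 0)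

/-- `h_u(r) = (1/2) ∫₀ʳ s u(s)² ds`. -/
def hFun (u : Plane → ℝ) (r : ℝ) : ℝ := (1 / 2) * ∫ s in (0 : ℝ)..r, s * profile u s ^ 2

/-! ### The function spaces -/

/-- Radial functions in `C₀^∞(ℝ²)`. -/
def IsRadialTestFunction (f : Plane → ℝ) : Prop :=
  ContDiff ℝ ∞ f ∧ HasCompactSupport f ∧ IsRadial f

/-- The pair `(u, G)` is a limit, in `L⁴ × L²`, of pairs `(φₙ, ∇φₙ)` with `φₙ` radial test functions.
Then `G` is the (almost everywhere unique) gradient of `u`. -/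
def IsLimitOfRadialTest (u : Plane → ℝ) (G : Plane → Plane) : Prop :=
  MemLp u 4 volume ∧ MemLp G 2 volume ∧
    ∃ f : ℕ → Plane → ℝ, (∀ n, IsRadialTestFunction (f n)) ∧
      Tendsto (fun n => eLpNorm (fun x => f n x - u x) 4 volume) atTop (𝓝 0) ∧
      Tendsto (fun n => eLpNorm (fun x => gradient (f n) x - G x) 2 volume) atTop (𝓝 0)

/-- The space `ℋ_r^{2,4}(ℝ²)`: the completion of the radial test functions with respect to the norm
`‖∇·‖₂ + ‖·‖₄`, realised as a space of functions. An element is given by a representative that is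
radial at every point, so that its profile makes sense up to null sets of radii. -/
def H24r : Set (Plane → ℝ) :=
  {u | IsRadial u ∧ ∃ G : Plane → Plane, IsLimitOfRadialTest u G}

open Classical in
/-- The gradient of an element of `ℋ_r^{2,4}(ℝ²)` (well defined almost everywhere); the value
outside that space is irrelevant. -/
def weakGrad (u : Plane → ℝ) : Plane → Plane :=
  if h : ∃ G : Plane → Plane, IsLimitOfRadialTest u G then h.choose else 0

/-- The energy functional
`E(u) = (1/2) ‖∇u‖₂² + (1/2) ∫ h_u² u² / |x|² dx - (1/(p+1)) ‖u‖_{p+1}^{p+1}`. -/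
def E (p : ℝ) (u : Plane → ℝ) : ℝ :=
  (1 / 2) * (∫ x, ‖weakGrad u x‖ ^ 2)
    + (1 / 2) * (∫ x, hFun u ‖x‖ ^ 2 * u x ^ 2 / ‖x‖ ^ 2)
    - (1 / (p + 1)) * (∫ x, |u x| ^ (p + 1))

/-- All the integrals in `E(u)` are finite. -/
def EFinite (p : ℝ) (u : Plane → ℝ) : Prop :=
  Integrable (fun x => ‖weakGrad u x‖ ^ 2) volume ∧
  Integrable (fun x => hFun u ‖x‖ ^ 2 * u x ^ 2 / ‖x‖ ^ 2) volume ∧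
  Integrable (fun x => |u x| ^ (p + 1)) volume

/-- The set `ℋ` of the elements of `ℋ_r^{2,4}(ℝ²)` with finite energy. -/
def H (p : ℝ) : Set (Plane → ℝ) := {u | u ∈ H24r ∧ EFinite p u}

/-! ### Classical solutions -/

/-- `U_u(x) = h_u(|x|)² / |x|²` for `x ≠ 0`, and `U_u(0) = 0`. -/
def U (u : Plane → ℝ) (x : Plane) : ℝ :=
  open Classical in if x = 0 then 0 else hFun u ‖x‖ ^ 2 / ‖x‖ ^ 2

/-- `V_u(x) = ∫_{|x|}^∞ (h_u(s) / s) u(s)² ds`. -/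
def V (u : Plane → ℝ) (x : Plane) : ℝ :=
  ∫ s in Set.Ioi ‖x‖, hFun u s / s * profile u s ^ 2

/-- Classical solutions of
`-Δu + (h_u²/|x|² + ∫_{|x|}^∞ (h_u(s)/s) u(s)² ds) u = |u|^{p-1} u` in `ℝ²`, `u → 0` at infinity. -/
structure IsClassicalSolution (p : ℝ) (u : Plane → ℝ) : Prop where
  radial : IsRadial u
  contDiff : ContDiff ℝ 2 u
  continuous_U : Continuous (U u)
  /-- `V_u` is well defined: the integral converges for every `x`. -/
  integrable_V : ∀ x : Plane,
    IntegrableOn (fun s => hFun u s / s * profile u s ^ 2) (Set.Ioi ‖x‖) volume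
  continuous_V : Continuous (V u)
  equation : ∀ x : Plane,
    -(Laplacian.laplacian u x) + (U u x + V u x) * u x = |u x| ^ (p - 1) * u x
  tendsto_zero : Tendsto u (cocompact Plane) (𝓝 0)

/-- The set `𝒮` of the nontrivial classical solutions belonging to `ℋ`. -/
def S (p : ℝ) : Set (Plane → ℝ) := {u | u ∈ H p ∧ u ≠ 0 ∧ IsClassicalSolution p u}

/-! ### The fields of the Chern-Simons-Schrödinger system -/

/-- A quadruplet `(φ, A₀, A₁, A₂)` of time-dependent fields on the plane. -/
structure Fields where
  φ : ℝ → Plane → ℂ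
  A₀ : ℝ → Plane → ℝ
  A₁ : ℝ → Plane → ℝ
  A₂ : ℝ → Plane → ℝ

namespace Fields

/-- The covariant derivative `D₁φ = ∂₁φ + i A₁ φ`. -/
def D₁ (F : Fields) (t : ℝ) (x : Plane) : ℂ :=
  fderiv ℝ (F.φ t) x (basisVec 0) + Complex.I * F.A₁ t x * F.φ t x

/-- The covariant derivative `D₂φ = ∂₂φ + i A₂ φ`. -/
def D₂ (F : Fields) (t : ℝ) (x : Plane) : ℂ :=
  fderiv ℝ (F.φ t) x (basisVec 1) + Complex.I * F.A₂ t x * F.φ t x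

/-- The energy at time `t`,
`(1/2) ∫ (|D₁φ|² + |D₂φ|²) dx - (1/(p+1)) ∫ |φ|^{p+1} dx`. -/
def energy (F : Fields) (p t : ℝ) : ℝ :=
  (1 / 2) * (∫ x, (‖F.D₁ t x‖ ^ 2 + ‖F.D₂ t x‖ ^ 2))
    - (1 / (p + 1)) * (∫ x, ‖F.φ t x‖ ^ (p + 1))

/-- Finiteness of the energy at time `t`. -/
def HasFiniteEnergy (F : Fields) (p t : ℝ) : Prop :=
  Integrable (fun x => ‖F.D₁ t x‖ ^ 2 + ‖F.D₂ t x‖ ^ 2) volume ∧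
  Integrable (fun x => ‖F.φ t x‖ ^ (p + 1)) volume

end Fields

/-- The static quadruplet generated by `u`: `φ = u`, `A₀ = V_u`,
`A₁ = -(x₂/|x|²) h_u(|x|)`, `A₂ = (x₁/|x|²) h_u(|x|)`. At `x = 0` the convention `a / 0 = 0` gives
`A₁ = A₂ = 0`, the continuous extension when `u` is continuous. -/
def staticFields (u : Plane → ℝ) : Fields where
  φ := fun _ x => (u x : ℂ)
  A₀ := fun _ x => V u x
  A₁ := fun _ x => -(x 1 / ‖x‖ ^ 2 * hFun u ‖x‖)
  A₂ := fun _ x => x 0 / ‖x‖ ^ 2 * hFun u ‖x‖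

end CSS

end

/-!
Write `w` for the profile of `u` and, in polar coordinates and without the factor `2π`,
`a = ∫ r w'²`, `b = ∫ h² w² / r`, `c = ∫ r |w| ^ (p + 1)`, `d = ∫ r w⁴`.

Since `h' = r w² / 2` and `V' = -h w² / r`, integrating `(2 h V)'` gives `∫ r V w² = 2 b`
(`integral_tailPotential`). Testing the radial equation with `w` and with `r w'` then gives the
identities `a + 3 b = c` (`nehari`) and `(p + 1) b = c` (`pohozaev`). Hence `a = (p - 2) b`, and
the energy is `E(u) = 2π (a / 2 + b / 2 - c / (p + 1)) = π (p - 3) b` (`energy_eq`), which is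
positive because `b = 0` would force `c = 0`. The boundary terms at infinity vanish without any
decay estimate: they converge, and after division by `r` they, or their squares, are integrable
near infinity (`limit_eq_zero_of_integrable_div`).

A lower bound for `b` comes from three facts. Integrating `(2 h w²)'` gives `d ≤ 2 (a + b)`
(`integral_four_le`), so that `d ≤ 4 a`. A radial Gagliardo–Nirenberg inequality
(`integral_pow_succ_le`) raises the exponent by two, and bounds `∫ r w ^ k` by a multiple of `a²`
for each even `k ≥ 6`, as long as `a ≤ 1`. Finally `p + 1 > 4` allows
`|w| ^ (p + 1) ≤ w⁴ / 8 + M w ^ k` with `k` large. Together, `a ≤ c ≤ a / 2 + C a²` with `C`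
depending on `p` only, which keeps `a`, and with it `b`, away from `0` (`exists_lower_bound`).

The space `ℋ_r^{2,4}` enters through the `L⁴` integrability of `u`, and through the fact that its
weak gradient is the classical one (`IsLimitOfRadialTest.ae_eq_gradient`). It follows that `E(u)` is
the energy of the static quadruplet.
-/

namespace CSS
open Set

/-! ### Integrals over half-lines -/

section HalfLine

variable {f : ℝ → ℝ}

lemma tail_eq (hf : IntegrableOn f (Ioi 0)) {r : ℝ} (hr : 0 ≤ r) :
    ∫ s in Ioi r, f s = (∫ s in Ioi 0, f s) - ∫ s in (0 : ℝ)..r, f s := by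
  rw [← intervalIntegral.integral_interval_add_Ioi hf (hf.mono_set (Ioi_subset_Ioi hr))]
  ring

lemma hasDerivAt_tail (hc : ContinuousOn f (Ioi 0)) (hf : IntegrableOn f (Ioi 0)) {r : ℝ}
    (hr : 0 < r) : HasDerivAt (fun r => ∫ s in Ioi r, f s) (-f r) r := by
  have h1 : HasDerivAt (fun r => ∫ s in (0 : ℝ)..r, f s) (f r) r := by
    refine intervalIntegral.integral_hasDerivAt_right ?_ ?_ (hc.continuousAt (Ioi_mem_nhds hr))
    · rw [intervalIntegrable_iff_integrableOn_Ioc_of_le hr.le]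
      exact hf.mono_set Ioc_subset_Ioi_self
    · exact hc.stronglyMeasurableAtFilter isOpen_Ioi r hr
  have h2 := h1.const_sub (∫ s in Ioi 0, f s)
  refine h2.congr_of_eventuallyEq ?_
  filter_upwards [Ioi_mem_nhds hr] with x hx
  exact tail_eq hf (le_of_lt hx)

lemma tendsto_tail (hf : IntegrableOn f (Ioi 0)) :
    Tendsto (fun r => ∫ s in Ioi r, f s) atTop (𝓝 0) := by
  have h1 := intervalIntegral_tendsto_integral_Ioi 0 hf tendsto_id
  have h2 := h1.const_sub (∫ s in Ioi 0, f s)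
  rw [sub_self] at h2
  refine h2.congr' ?_
  filter_upwards [eventually_ge_atTop 0] with x hx
  exact (tail_eq hf hx).symm

/-- The weight `1 / r` is not integrable at infinity, so a limit `L ≠ 0` of `F` would contradict
the integrability of `F / r`. -/
lemma limit_eq_zero_of_integrable_div {F : ℝ → ℝ} {L R : ℝ} (hF : Tendsto F atTop (𝓝 L))
    (hint : IntegrableOn (fun r => F r / r) (Ioi R)) : L = 0 := by
  by_contra hL
  have hL' : 0 < |L| := abs_pos.2 hL
  have h1 : ∀ᶠ r in atTop, |L| / 2 < |F r| := hF.abs.eventually (lt_mem_nhds (by linarith))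
  obtain ⟨R', hR'⟩ := eventually_atTop.1
    ((h1.and (eventually_ge_atTop R)).and (eventually_gt_atTop 0))
  have hRR : R ≤ R' := (hR' R' le_rfl).1.2
  refine not_integrableOn_Ioi_inv (a := R') ?_
  have h2 : IntegrableOn (fun r => (2 / |L|) * |F r / r|) (Ioi R') :=
    ((hint.mono_set (Ioi_subset_Ioi hRR)).abs).const_mul _
  refine Integrable.mono' h2 (by fun_prop) ?_
  filter_upwards [self_mem_ae_restrict measurableSet_Ioi] with r hr
  obtain ⟨⟨hF1, -⟩, hr0⟩ := hR' r (le_of_lt hr)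
  rw [Real.norm_eq_abs, abs_inv, abs_div, abs_of_pos hr0, ← mul_div_assoc, ← one_div]
  gcongr
  rw [div_mul_eq_mul_div, le_div_iff₀ hL']
  linarith

/-- If `F` vanishes at `0`, and both `F'` and `F / r` are integrable, then `F` also vanishes at
infinity, and `F'` has integral `0`. -/
lemma integral_deriv_eq_zero {F F' : ℝ → ℝ} (hcont : ContinuousWithinAt F (Ici 0) 0)
    (h0 : F 0 = 0) (hderiv : ∀ r ∈ Ioi (0 : ℝ), HasDerivAt F (F' r) r)
    (hint : IntegrableOn F' (Ioi 0)) (hdiv : IntegrableOn (fun r => F r / r) (Ioi 0)) :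
    ∫ r in Ioi 0, F' r = 0 := by
  have hlim := tendsto_limUnder_of_hasDerivAt_of_integrableOn_Ioi hderiv hint
  have hL := limit_eq_zero_of_integrable_div hlim hdiv
  rw [hL] at hlim
  rw [integral_Ioi_of_hasDerivAt_of_tendsto hcont hderiv hint hlim, h0, sub_zero]

/-- A Hardy-type inequality for the tails `k(r) = ∫_r^∞ f` of a nonnegative function: since
`r k(r) ≤ ∫ s f(s) ds` and `∫ k = ∫ s f(s) ds`, the integral of `r k(r)²` is at most the square
of `∫ s f(s) ds`. -/
lemma integral_mul_tail_sq_le (hc : Continuous f) (hf0 : ∀ r, 0 ≤ f r)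
    (hf : IntegrableOn (fun r => r * f r) (Ioi 0)) :
    IntegrableOn f (Ioi 0) ∧
    IntegrableOn (fun r => r * (∫ s in Ioi r, f s) ^ 2) (Ioi 0) ∧
    ∫ r in Ioi 0, r * (∫ s in Ioi r, f s) ^ 2 ≤ (∫ r in Ioi 0, r * f r) ^ 2 := by
  have hfi : IntegrableOn f (Ioi 0) := by
    rw [← Ioc_union_Ioi_eq_Ioi zero_le_one]
    refine IntegrableOn.union (hc.integrableOn_Ioc) ?_
    refine Integrable.mono' (hf.mono_set (Ioi_subset_Ioi zero_le_one))
      hc.aestronglyMeasurable ?_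
    filter_upwards [self_mem_ae_restrict measurableSet_Ioi] with r hr
    rw [Real.norm_of_nonneg (hf0 r)]
    have : (1 : ℝ) < r := hr
    nlinarith [hf0 r]
  refine ⟨hfi, ?_⟩
  set k : ℝ → ℝ := fun r => ∫ s in Ioi r, f s with hk
  set T : ℝ → ℝ := fun r => ∫ s in Ioi r, s * f s with hT
  have hk0 : ∀ r, 0 ≤ k r := fun r => integral_nonneg fun s => hf0 s
  have hcm : Continuous fun r => r * f r := by fun_prop
  have hkd : ∀ r ∈ Ioi (0 : ℝ), HasDerivAt k (-f r) r := fun r hr =>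
    hasDerivAt_tail hc.continuousOn hfi hr
  have hTd : ∀ r ∈ Ioi (0 : ℝ), HasDerivAt T (-(r * f r)) r := fun r hr =>
    hasDerivAt_tail hcm.continuousOn hf hr
  have hkT : ∀ r, 0 < r → r * k r ≤ T r := by
    intro r hr
    rw [hk, hT]
    simp only
    rw [← integral_const_mul]
    refine setIntegral_mono_on ((hfi.mono_set (Ioi_subset_Ioi hr.le)).const_mul r)
      (hf.mono_set (Ioi_subset_Ioi hr.le)) measurableSet_Ioi fun s hs => ?_
    exact mul_le_mul_of_nonneg_right (le_of_lt hs) (hf0 s)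
  have hTG : ∀ r, 0 < r → T r ≤ T 0 := by
    intro r hr
    refine setIntegral_mono_set hf ?_ (Ioi_subset_Ioi hr.le).eventuallyLE
    filter_upwards [self_mem_ae_restrict measurableSet_Ioi] with s hs
    exact mul_nonneg (le_of_lt hs) (hf0 s)
  have hTlim : Tendsto T atTop (𝓝 0) := tendsto_tail hf
  have hlim : Tendsto (fun r => r * k r - T r) atTop (𝓝 0) := by
    have h1 : Tendsto (fun r => r * k r) atTop (𝓝 0) := by
      refine squeeze_zero' ?_ ?_ hTlim
      · filter_upwards [eventually_gt_atTop 0] with r hr using mul_nonneg hr.le (hk0 r)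
      · filter_upwards [eventually_gt_atTop 0] with r hr using hkT r hr
    simpa using h1.sub hTlim
  have hcont : ContinuousWithinAt (fun r => r * k r - T r) (Ici 0) 0 :=
    (continuousWithinAt_id.mul hfi.continuousWithinAt_Ici_primitive_Ioi).sub
      hf.continuousWithinAt_Ici_primitive_Ioi
  have hd : ∀ r ∈ Ioi (0 : ℝ), HasDerivAt (fun r => r * k r - T r) (k r) r := by
    intro r hr
    refine (((hasDerivAt_id r).mul (hkd r hr)).sub (hTd r hr)).congr_deriv ?_
    simp
  have hki : IntegrableOn k (Ioi 0) :=
    integrableOn_Ioi_deriv_of_nonneg hcont hd (fun r _ => hk0 r) hlim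
  have hkI : ∫ r in Ioi 0, k r = T 0 := by
    rw [integral_Ioi_of_hasDerivAt_of_tendsto hcont hd hki hlim]
    simp
  have hkc : ContinuousOn k (Ioi 0) := fun r hr => (hkd r hr).continuousAt.continuousWithinAt
  have hpt : ∀ r ∈ Ioi (0 : ℝ), r * k r ^ 2 ≤ T 0 * k r := by
    intro r hr
    have h1 := (hkT r hr).trans (hTG r hr)
    nlinarith [hk0 r]
  have hint : IntegrableOn (fun r => r * k r ^ 2) (Ioi 0) := by
    refine Integrable.mono' (hki.const_mul (T 0))
      ((continuousOn_id.mul (hkc.pow 2)).aestronglyMeasurable measurableSet_Ioi) ?_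
    filter_upwards [self_mem_ae_restrict measurableSet_Ioi] with r hr
    rw [Real.norm_of_nonneg (mul_nonneg (le_of_lt hr) (sq_nonneg _))]
    exact hpt r hr
  refine ⟨hint, ?_⟩
  calc ∫ r in Ioi 0, r * k r ^ 2 ≤ ∫ r in Ioi 0, T 0 * k r :=
        setIntegral_mono_on hint (hki.const_mul _) measurableSet_Ioi hpt
    _ = (T 0) ^ 2 := by rw [integral_const_mul, hkI, sq]

end HalfLine

/-! ### The radial equation and its integral identities -/

/-- `h(r) = (1/2) ∫₀ʳ s w(s)² ds`, for a profile `w` on the line. -/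
noncomputable def charge (w : ℝ → ℝ) (r : ℝ) : ℝ := (1 / 2) * ∫ s in (0 : ℝ)..r, s * w s ^ 2

/-- `∫_r^∞ (h(s) / s) w(s)² ds`, for a profile `w` on the line. -/
noncomputable def tailPotential (w : ℝ → ℝ) (r : ℝ) : ℝ :=
  ∫ s in Ioi r, charge w s / s * w s ^ 2

/-- Profiles of classical solutions with finite energy that belong to `L⁴`, with all integrals
written in polar coordinates, without the factor `2π`. -/
structure IsRadialSolution (p : ℝ) (w : ℝ → ℝ) : Prop where
  contDiff : ContDiff ℝ 2 w
  tendsto_zero : Tendsto w atTop (𝓝 0)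
  ode : ∀ r, 0 < r → deriv (deriv w) r + deriv w r / r
    = (charge w r ^ 2 / r ^ 2 + tailPotential w r) * w r - |w r| ^ (p - 1) * w r
  integrable_potential : IntegrableOn (fun s => charge w s / s * w s ^ 2) (Ioi 0)
  integrable_deriv : IntegrableOn (fun r => r * deriv w r ^ 2) (Ioi 0)
  integrable_gauge : IntegrableOn (fun r => charge w r ^ 2 * w r ^ 2 / r) (Ioi 0)
  integrable_rpow : IntegrableOn (fun r => r * |w r| ^ (p + 1)) (Ioi 0)
  integrable_four : IntegrableOn (fun r => r * w r ^ 4) (Ioi 0)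

lemma contDiff_one_deriv {w : ℝ → ℝ} (hw : ContDiff ℝ 2 w) : ContDiff ℝ 1 (deriv w) :=
  ((contDiff_succ_iff_deriv (n := 1)).1 (by rw [one_add_one_eq_two]; exact hw)).2.2

lemma hasDerivAt_charge {w : ℝ → ℝ} (hw : Continuous w) (r : ℝ) :
    HasDerivAt (charge w) (r * w r ^ 2 / 2) r := by
  have hc : Continuous fun s => s * w s ^ 2 := by fun_prop
  refine ((intervalIntegral.integral_hasDerivAt_right (hc.intervalIntegrable 0 r)
    (hc.stronglyMeasurableAtFilter _ _) hc.continuousAt).const_mul (1 / 2)).congr_deriv ?_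
  ring

lemma continuous_charge {w : ℝ → ℝ} (hw : Continuous w) : Continuous (charge w) :=
  continuous_iff_continuousAt.2 fun r => (hasDerivAt_charge hw r).continuousAt

@[simp] lemma charge_zero (w : ℝ → ℝ) : charge w 0 = 0 := by simp [charge]

lemma charge_mono {w : ℝ → ℝ} (hw : Continuous w) {r s : ℝ} (hr : 0 ≤ r) (hrs : r ≤ s) :
    charge w r ≤ charge w s := by
  refine monotoneOn_of_deriv_nonneg (convex_Ici 0) (continuous_charge hw).continuousOn
    (fun x _ => (hasDerivAt_charge hw x).differentiableAt.differentiableWithinAt) ?_ hr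
    (hr.trans hrs) hrs
  intro x hx
  rw [interior_Ici] at hx
  have : (0 : ℝ) < x := hx
  rw [(hasDerivAt_charge hw x).deriv]
  positivity

lemma charge_nonneg {w : ℝ → ℝ} (hw : Continuous w) {r : ℝ} (hr : 0 ≤ r) : 0 ≤ charge w r := by
  simpa using charge_mono hw le_rfl hr

namespace IsRadialSolution

variable {p : ℝ} {w : ℝ → ℝ}

lemma continuous (hw : IsRadialSolution p w) : Continuous w := hw.contDiff.continuous

lemma hasDerivAt (hw : IsRadialSolution p w) (r : ℝ) : HasDerivAt w (deriv w r) r :=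
  (hw.contDiff.differentiable (by norm_num) r).hasDerivAt

lemma contDiff_deriv (hw : IsRadialSolution p w) : ContDiff ℝ 1 (deriv w) :=
  contDiff_one_deriv hw.contDiff

lemma continuous_deriv (hw : IsRadialSolution p w) : Continuous (deriv w) :=
  hw.contDiff_deriv.continuous

lemma hasDerivAt_deriv (hw : IsRadialSolution p w) (r : ℝ) :
    HasDerivAt (deriv w) (deriv (deriv w) r) r :=
  (hw.contDiff_deriv.differentiable (by norm_num) r).hasDerivAt

lemma hasDerivAt_tailPotential (hw : IsRadialSolution p w) {r : ℝ} (hr : 0 < r) :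
    HasDerivAt (tailPotential w) (-(charge w r / r * w r ^ 2)) r := by
  refine hasDerivAt_tail ?_ hw.integrable_potential hr
  refine ContinuousOn.mul (ContinuousOn.div (continuous_charge hw.continuous).continuousOn
    continuousOn_id fun x hx => ne_of_gt hx) (hw.continuous.pow 2).continuousOn

lemma continuousWithinAt_tailPotential (hw : IsRadialSolution p w) :
    ContinuousWithinAt (tailPotential w) (Ici 0) 0 :=
  hw.integrable_potential.continuousWithinAt_Ici_primitive_Ioi

lemma tailPotential_nonneg (hw : IsRadialSolution p w) {r : ℝ} (hr : 0 ≤ r) :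
    0 ≤ tailPotential w r := by
  refine setIntegral_nonneg measurableSet_Ioi fun s hs => ?_
  have h0 : 0 ≤ s := hr.trans (le_of_lt hs)
  have := charge_nonneg hw.continuous h0
  positivity

/-- The two nonlocal terms of the potential are related by `∫ V u² = 2 ∫ U u²`, as seen by
integrating `(2 h V)' = r w² V - 2 h² w² / r`. -/
lemma integral_tailPotential (hw : IsRadialSolution p w) :
    IntegrableOn (fun r => r * w r ^ 2 * tailPotential w r) (Ioi 0) ∧
    ∫ r in Ioi 0, r * w r ^ 2 * tailPotential w r
      = 2 * ∫ r in Ioi 0, charge w r ^ 2 * w r ^ 2 / r := by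
  have hch := continuous_charge hw.continuous
  set T : ℝ → ℝ := fun r => ∫ s in Ioi r, charge w s ^ 2 * w s ^ 2 / s with hT
  have hTd : ∀ r ∈ Ioi (0 : ℝ), HasDerivAt T (-(charge w r ^ 2 * w r ^ 2 / r)) r := by
    intro r hr
    refine hasDerivAt_tail ?_ hw.integrable_gauge hr
    exact ((hch.pow 2).mul (hw.continuous.pow 2)).continuousOn.div continuousOn_id
      fun x hx => ne_of_gt hx
  have hTlim : Tendsto T atTop (𝓝 0) := tendsto_tail hw.integrable_gauge
  have hd : ∀ r ∈ Ioi (0 : ℝ),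
      HasDerivAt (fun r => 2 * (charge w r * tailPotential w r) - 2 * T r)
        (r * w r ^ 2 * tailPotential w r) r := by
    intro r hr
    have hr0 : r ≠ 0 := ne_of_gt hr
    refine ((((hasDerivAt_charge hw.continuous r).mul (hw.hasDerivAt_tailPotential hr)).const_mul
      2).sub ((hTd r hr).const_mul 2)).congr_deriv ?_
    field_simp
    ring
  have hle : ∀ r, 0 < r → charge w r * tailPotential w r ≤ T r := by
    intro r hr
    rw [hT, tailPotential]
    simp only
    rw [← integral_const_mul]
    refine setIntegral_mono_on
      ((hw.integrable_potential.mono_set (Ioi_subset_Ioi hr.le)).const_mul _)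
      (hw.integrable_gauge.mono_set (Ioi_subset_Ioi hr.le)) measurableSet_Ioi fun s hs => ?_
    have hs0 : 0 < s := hr.trans hs
    have h1 := charge_mono hw.continuous hr.le (le_of_lt hs)
    have h2 := charge_nonneg hw.continuous hs0.le
    calc charge w r * (charge w s / s * w s ^ 2) ≤ charge w s * (charge w s / s * w s ^ 2) := by
          gcongr
      _ = charge w s ^ 2 * w s ^ 2 / s := by ring
  have hlim : Tendsto (fun r => 2 * (charge w r * tailPotential w r) - 2 * T r) atTop (𝓝 0) := by
    have h1 : Tendsto (fun r => charge w r * tailPotential w r) atTop (𝓝 0) := by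
      refine squeeze_zero' ?_ ?_ hTlim
      · filter_upwards [eventually_gt_atTop 0] with r hr using
          mul_nonneg (charge_nonneg hw.continuous hr.le) (hw.tailPotential_nonneg hr.le)
      · filter_upwards [eventually_gt_atTop 0] with r hr using hle r hr
    simpa using (h1.const_mul 2).sub (hTlim.const_mul 2)
  have hcont : ContinuousWithinAt (fun r => 2 * (charge w r * tailPotential w r) - 2 * T r)
      (Ici 0) 0 :=
    ((hch.continuousWithinAt.mul hw.continuousWithinAt_tailPotential).const_mul 2).sub
      ((hw.integrable_gauge.continuousWithinAt_Ici_primitive_Ioi).const_mul 2)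
  have hint := integrableOn_Ioi_deriv_of_nonneg hcont hd (fun r hr =>
    mul_nonneg (mul_nonneg (le_of_lt hr) (sq_nonneg _)) (hw.tailPotential_nonneg (le_of_lt hr)))
    hlim
  refine ⟨hint, ?_⟩
  rw [integral_Ioi_of_hasDerivAt_of_tendsto hcont hd hint hlim]
  simp [hT]

/-- The identity obtained by testing the equation with the solution itself. -/
lemma nehari (hp : 0 < p) (hw : IsRadialSolution p w) :
    (∫ r in Ioi 0, r * deriv w r ^ 2) + 3 * (∫ r in Ioi 0, charge w r ^ 2 * w r ^ 2 / r)
      = ∫ r in Ioi 0, r * |w r| ^ (p + 1) := by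
  obtain ⟨hVi, hV⟩ := hw.integral_tailPotential
  have hd : ∀ r ∈ Ioi (0 : ℝ), HasDerivAt (fun r => r * deriv w r * w r)
      (r * deriv w r ^ 2 + charge w r ^ 2 * w r ^ 2 / r + r * w r ^ 2 * tailPotential w r
        - r * |w r| ^ (p + 1)) r := by
    intro r hr
    have hr0 : r ≠ 0 := ne_of_gt hr
    refine ((((hasDerivAt_id r).mul (hw.hasDerivAt_deriv r)).mul (hw.hasDerivAt r))).congr_deriv ?_
    have hode := hw.ode r hr
    have habs : |w r| ^ (p + 1) = |w r| ^ (p - 1) * w r * w r := by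
      rw [show p + 1 = (p - 1) + 2 by ring]
      by_cases h : w r = 0
      · simp [h, show p - 1 + 2 ≠ 0 by linarith]
      · rw [Real.rpow_add (abs_pos.2 h), Real.rpow_two, sq_abs]
        ring
    have h2 : deriv (deriv w) r = (charge w r ^ 2 / r ^ 2 + tailPotential w r) * w r
        - |w r| ^ (p - 1) * w r - deriv w r / r := by linarith
    simp only [id_eq, Pi.mul_apply]
    rw [habs, h2]
    field_simp
    ring
  have hint := ((hw.integrable_deriv.add hw.integrable_gauge).add hVi).sub hw.integrable_rpow
  have hlim := tendsto_limUnder_of_hasDerivAt_of_integrableOn_Ioi hd hint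
  -- The square of `r w' w`, divided by `r`, is at most `r w'²` near infinity, hence integrable.
  have hL : limUnder atTop (fun r => r * deriv w r * w r) = 0 := by
    obtain ⟨R, hR⟩ := eventually_atTop.1
      ((hw.tendsto_zero.abs.eventually (gt_mem_nhds (by norm_num : |(0 : ℝ)| < 1))).and
        (eventually_gt_atTop 0))
    have hR0 : 0 < R := (hR R le_rfl).2
    have hsq := limit_eq_zero_of_integrable_div (hlim.pow 2) (R := R) ?_
    · exact pow_eq_zero_iff (two_ne_zero) |>.1 hsq
    have hc : ContinuousOn (fun r => (r * deriv w r * w r) ^ 2 / r) (Ioi R) := by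
      refine ContinuousOn.div ?_ continuousOn_id fun x hx => ne_of_gt (hR0.trans hx)
      have h1 := hw.continuous
      have h2 := hw.continuous_deriv
      exact (by fun_prop : Continuous fun r => (r * deriv w r * w r) ^ 2).continuousOn
    refine Integrable.mono' (hw.integrable_deriv.mono_set (Ioi_subset_Ioi hR0.le))
      (hc.aestronglyMeasurable measurableSet_Ioi) ?_
    filter_upwards [self_mem_ae_restrict measurableSet_Ioi] with r hr
    have hr0 : 0 < r := hR0.trans hr
    have hw1 : w r ^ 2 ≤ 1 := by
      rw [← sq_abs]
      have := (hR r (le_of_lt hr)).1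
      nlinarith [abs_nonneg (w r)]
    rw [Real.norm_of_nonneg (by positivity),
      show (r * deriv w r * w r) ^ 2 / r = r * deriv w r ^ 2 * w r ^ 2 by field_simp]
    exact mul_le_of_le_one_right (by positivity) hw1
  rw [hL] at hlim
  have hcont : ContinuousWithinAt (fun r => r * deriv w r * w r) (Ici 0) 0 := by
    have h1 := hw.continuous
    have h2 := hw.continuous_deriv
    exact (by fun_prop : Continuous fun r => r * deriv w r * w r).continuousWithinAt
  have key := integral_Ioi_of_hasDerivAt_of_tendsto hcont hd hint hlim
  rw [integral_sub, integral_add, integral_add, hV] at key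
  · simp only [zero_mul, sub_zero] at key
    linarith
  exacts [hw.integrable_deriv, hw.integrable_gauge, hw.integrable_deriv.add hw.integrable_gauge,
    hVi, (hw.integrable_deriv.add hw.integrable_gauge).add hVi, hw.integrable_rpow]

/-- The Pohozaev identity, obtained by testing the equation with `r w'`. The contributions
`± r h w⁴ / 2` of the two nonlocal terms cancel each other. -/
lemma pohozaev (hp : 0 < p) (hw : IsRadialSolution p w) :
    (p + 1) * (∫ r in Ioi 0, charge w r ^ 2 * w r ^ 2 / r)
      = ∫ r in Ioi 0, r * |w r| ^ (p + 1) := by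
  obtain ⟨hVi, hV⟩ := hw.integral_tailPotential
  have hp1 : p + 1 ≠ 0 := by linarith
  have h1 := hw.continuous
  have h2 := hw.continuous_deriv
  have h3 := continuous_charge hw.continuous
  have habsc : Continuous fun r => |w r| ^ (p + 1) :=
    h1.abs.rpow_const fun _ => Or.inr (by linarith)
  have hd : ∀ r ∈ Ioi (0 : ℝ), HasDerivAt
      (fun r => (r * deriv w r) ^ 2 / 2 - charge w r ^ 2 * w r ^ 2 / 2
        - r ^ 2 * w r ^ 2 * tailPotential w r / 2 + r ^ 2 * |w r| ^ (p + 1) / (p + 1))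
      (2 / (p + 1) * (r * |w r| ^ (p + 1)) - r * w r ^ 2 * tailPotential w r) r := by
    intro r hr
    have hr0 : r ≠ 0 := ne_of_gt hr
    have hwd := hw.hasDerivAt r
    have dabs : HasDerivAt (fun r => |w r| ^ (p + 1))
        ((p + 1) * |w r| ^ (p + 1 - 2) * w r * deriv w r) r :=
      (hasDerivAt_abs_rpow (w r) (by linarith : 1 < p + 1)).comp r hwd
    have d1 := (((hasDerivAt_id r).mul (hw.hasDerivAt_deriv r)).pow 2).div_const 2
    have d2 := (((hasDerivAt_charge h1 r).pow 2).mul (hwd.pow 2)).div_const 2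
    have d3 := ((((hasDerivAt_id r).pow 2).mul (hwd.pow 2)).mul
      (hw.hasDerivAt_tailPotential hr)).div_const 2
    have d4 := (((hasDerivAt_id r).pow 2).mul dabs).div_const (p + 1)
    refine (((d1.sub d2).sub d3).add d4).congr_deriv ?_
    have hode := hw.ode r hr
    have e2 : deriv (deriv w) r = (charge w r ^ 2 / r ^ 2 + tailPotential w r) * w r
        - |w r| ^ (p - 1) * w r - deriv w r / r := by linarith
    rw [show p + 1 - 2 = p - 1 by ring]
    simp only [id_eq, Pi.mul_apply, Pi.pow_apply, Nat.cast_ofNat]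
    rw [e2]
    field_simp
    ring
  have hint : IntegrableOn
      (fun r => 2 / (p + 1) * (r * |w r| ^ (p + 1)) - r * w r ^ 2 * tailPotential w r) (Ioi 0) :=
    (hw.integrable_rpow.const_mul _).sub hVi
  have hcont : ContinuousWithinAt
      (fun r => (r * deriv w r) ^ 2 / 2 - charge w r ^ 2 * w r ^ 2 / 2
        - r ^ 2 * w r ^ 2 * tailPotential w r / 2 + r ^ 2 * |w r| ^ (p + 1) / (p + 1))
      (Ici 0) 0 := by
    refine ContinuousWithinAt.add (ContinuousWithinAt.sub ?_ ?_) ?_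
    · exact (by fun_prop : Continuous fun r =>
        (r * deriv w r) ^ 2 / 2 - charge w r ^ 2 * w r ^ 2 / 2).continuousWithinAt
    · exact ((by fun_prop : Continuous fun r => r ^ 2 * w r ^ 2).continuousWithinAt.mul
        hw.continuousWithinAt_tailPotential).div_const 2
    · exact (by fun_prop : Continuous fun r =>
        r ^ 2 * |w r| ^ (p + 1) / (p + 1)).continuousWithinAt
  have hdiv : IntegrableOn (fun r => ((r * deriv w r) ^ 2 / 2 - charge w r ^ 2 * w r ^ 2 / 2
        - r ^ 2 * w r ^ 2 * tailPotential w r / 2 + r ^ 2 * |w r| ^ (p + 1) / (p + 1)) / r)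
      (Ioi 0) := by
    refine IntegrableOn.congr_fun ((((hw.integrable_deriv.div_const 2).sub
      (hw.integrable_gauge.div_const 2)).sub (hVi.div_const 2)).add
      (hw.integrable_rpow.div_const (p + 1))) ?_ measurableSet_Ioi
    intro r hr
    have hr0 : r ≠ 0 := ne_of_gt hr
    simp only [Pi.add_apply, Pi.sub_apply]
    field_simp
  have key := integral_deriv_eq_zero hcont (by simp) hd hint hdiv
  rw [integral_sub (hw.integrable_rpow.const_mul _) hVi, integral_const_mul, hV] at key
  field_simp at key
  linarith

/-- The `L⁴` norm is controlled by the gradient and the gauge term, as seen by integrating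
`(2 h w²)' = r w⁴ + 4 h w w'`. -/
lemma integral_four_le (hw : IsRadialSolution p w) :
    ∫ r in Ioi 0, r * w r ^ 4
      ≤ 2 * ((∫ r in Ioi 0, r * deriv w r ^ 2) + ∫ r in Ioi 0, charge w r ^ 2 * w r ^ 2 / r) := by
  have h1 := hw.continuous
  have h2 := hw.continuous_deriv
  have h3 := continuous_charge hw.continuous
  have hbd : ∀ r ∈ Ioi (0 : ℝ), |4 * (charge w r * w r * deriv w r)|
      ≤ 2 * (r * deriv w r ^ 2 + charge w r ^ 2 * w r ^ 2 / r) := by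
    intro r hr
    have hr' : (0 : ℝ) < r := hr
    rw [abs_le]
    have e : r * deriv w r ^ 2 + charge w r ^ 2 * w r ^ 2 / r
        = ((r * deriv w r) ^ 2 + (charge w r * w r) ^ 2) / r := by field_simp
    rw [e]
    constructor
    · rw [← sub_nonneg]
      have : 2 * (((r * deriv w r) ^ 2 + (charge w r * w r) ^ 2) / r)
          + 4 * (charge w r * w r * deriv w r)
          = 2 * (r * deriv w r + charge w r * w r) ^ 2 / r := by field_simp; ring
      have h0 : 0 ≤ 2 * (r * deriv w r + charge w r * w r) ^ 2 / r := by positivity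
      linarith
    · rw [← sub_nonneg]
      have : 2 * (((r * deriv w r) ^ 2 + (charge w r * w r) ^ 2) / r)
          - 4 * (charge w r * w r * deriv w r)
          = 2 * (r * deriv w r - charge w r * w r) ^ 2 / r := by field_simp; ring
      have h0 : 0 ≤ 2 * (r * deriv w r - charge w r * w r) ^ 2 / r := by positivity
      linarith
  have hsum := (hw.integrable_deriv.add hw.integrable_gauge).const_mul 2
  have hci : IntegrableOn (fun r => 4 * (charge w r * w r * deriv w r)) (Ioi 0) := by
    refine Integrable.mono' hsum (by fun_prop) ?_
    filter_upwards [self_mem_ae_restrict measurableSet_Ioi] with r hr using hbd r hr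
  have hd : ∀ r ∈ Ioi (0 : ℝ), HasDerivAt (fun r => 2 * (charge w r * w r ^ 2))
      (r * w r ^ 4 + 4 * (charge w r * w r * deriv w r)) r := by
    intro r _
    refine (((hasDerivAt_charge h1 r).mul ((hw.hasDerivAt r).pow 2)).const_mul 2).congr_deriv ?_
    simp
    ring
  have hdiv : IntegrableOn (fun r => 2 * (charge w r * w r ^ 2) / r) (Ioi 0) := by
    refine IntegrableOn.congr_fun (hw.integrable_potential.const_mul 2) ?_ measurableSet_Ioi
    intro r _
    simp only
    ring
  have key := integral_deriv_eq_zero (by fun_prop) (by simp) hd (hw.integrable_four.add hci) hdiv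
  rw [integral_add hw.integrable_four hci] at key
  have h4 : -(∫ r in Ioi 0, 4 * (charge w r * w r * deriv w r))
      ≤ ∫ r in Ioi 0, 2 * (r * deriv w r ^ 2 + charge w r ^ 2 * w r ^ 2 / r) := by
    rw [← integral_neg]
    exact setIntegral_mono_on hci.neg hsum measurableSet_Ioi fun r hr =>
      (neg_le_abs _).trans (hbd r hr)
  rw [integral_const_mul (2 : ℝ), integral_add hw.integrable_deriv hw.integrable_gauge] at h4
  linarith

end IsRadialSolution

/-! ### A priori lower bound for the gauge term -/

/-- Interpolation of the exponent `q` between `4` and `m`, with a small coefficient in front of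
the fourth power. -/
lemma exists_rpow_le {q : ℝ} (hq : 4 < q) {m : ℕ} (hm : q ≤ m) :
    ∃ M : ℝ, 0 < M ∧ ∀ t : ℝ, 0 ≤ t → t ^ q ≤ (1 / 8) * t ^ 4 + M * t ^ m := by
  set δ : ℝ := (1 / 8 : ℝ) ^ (1 / (q - 4)) with hδ
  have hδ0 : 0 < δ := by positivity
  have hδq : δ ^ (q - 4) = 1 / 8 := by
    rw [hδ, ← Real.rpow_mul (by norm_num), one_div_mul_cancel (by linarith), Real.rpow_one]
  refine ⟨δ ^ (q - m), by positivity, fun t ht => ?_⟩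
  rcases ht.eq_or_lt with rfl | ht0
  · rw [Real.zero_rpow (by linarith)]
    positivity
  rcases le_or_gt t δ with h | h
  · have h1 : t ^ q = t ^ (q - 4) * t ^ 4 := by
      rw [← Real.rpow_natCast t 4, ← Real.rpow_add ht0]
      norm_num
    have h2 : t ^ (q - 4) ≤ 1 / 8 := hδq ▸ Real.rpow_le_rpow ht h (by linarith)
    have h3 : 0 ≤ δ ^ (q - m) * t ^ m := by positivity
    rw [h1]
    nlinarith [pow_pos ht0 4]
  · have h1 : t ^ q = t ^ (q - m) * t ^ m := by
      rw [← Real.rpow_natCast t m, ← Real.rpow_add ht0]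
      congr 1
      ring
    have h2 : t ^ (q - m) ≤ δ ^ (q - m) :=
      Real.rpow_le_rpow_of_nonpos hδ0 h.le (by linarith)
    have h3 : 0 ≤ (1 / 8) * t ^ 4 := by positivity
    rw [h1]
    nlinarith [pow_pos ht0 m]

namespace IsRadialSolution

variable {p : ℝ} {w : ℝ → ℝ}

/-- A radial Gagliardo–Nirenberg inequality: the Hardy-type inequality for tails, applied to the
derivative of `w ^ (n + 1)`, raises the exponent by two. -/
lemma integral_pow_succ_le (hw : IsRadialSolution p w) (n : ℕ)
    (hi : IntegrableOn (fun r => r * w r ^ (2 * n)) (Ioi 0)) :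
    IntegrableOn (fun r => r * w r ^ (2 * (n + 1))) (Ioi 0) ∧
    ∫ r in Ioi 0, r * w r ^ (2 * (n + 1)) ≤ (((n : ℝ) + 1) / 2 *
      ((∫ r in Ioi 0, r * deriv w r ^ 2) + ∫ r in Ioi 0, r * w r ^ (2 * n))) ^ 2 := by
  have h1 := hw.continuous
  have h2 := hw.continuous_deriv
  set f : ℝ → ℝ := fun r => |((n : ℝ) + 1) * w r ^ n * deriv w r| with hf
  have hfc : Continuous f := by fun_prop
  have hf0 : ∀ r, 0 ≤ f r := fun r => abs_nonneg _
  have hbd : ∀ r ∈ Ioi (0 : ℝ),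
      r * f r ≤ ((n : ℝ) + 1) / 2 * (r * deriv w r ^ 2 + r * w r ^ (2 * n)) := by
    intro r hr
    have hr' : (0 : ℝ) < r := hr
    have e : f r = ((n : ℝ) + 1) * (|w r ^ n| * |deriv w r|) := by
      rw [hf]
      simp only
      rw [abs_mul, abs_mul, abs_of_nonneg (by positivity : (0 : ℝ) ≤ n + 1), mul_assoc]
    have h3 : |w r ^ n| * |deriv w r| ≤ (deriv w r ^ 2 + w r ^ (2 * n)) / 2 := by
      have := two_mul_le_add_sq |w r ^ n| |deriv w r|
      rw [sq_abs, sq_abs, ← pow_mul, mul_comm n 2] at this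
      linarith
    calc r * f r = (r * ((n : ℝ) + 1)) * (|w r ^ n| * |deriv w r|) := by rw [e]; ring
      _ ≤ (r * ((n : ℝ) + 1)) * ((deriv w r ^ 2 + w r ^ (2 * n)) / 2) := by gcongr
      _ = _ := by ring
  have hsum : IntegrableOn
      (fun r => ((n : ℝ) + 1) / 2 * (r * deriv w r ^ 2 + r * w r ^ (2 * n))) (Ioi 0) :=
    (hw.integrable_deriv.add hi).const_mul _
  have hfi : IntegrableOn (fun r => r * f r) (Ioi 0) := by
    refine Integrable.mono' hsum (by fun_prop) ?_
    filter_upwards [self_mem_ae_restrict measurableSet_Ioi] with r hr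
    rw [Real.norm_of_nonneg (mul_nonneg (le_of_lt hr) (hf0 r))]
    exact hbd r hr
  obtain ⟨hfi0, hki, hkle⟩ := integral_mul_tail_sq_le hfc hf0 hfi
  have hpow : ∀ r ∈ Ioi (0 : ℝ),
      r * w r ^ (2 * (n + 1)) ≤ r * (∫ s in Ioi r, f s) ^ 2 := by
    intro r hr
    have hr' : (0 : ℝ) < r := hr
    have hd : ∀ s ∈ Ici r,
        HasDerivAt (fun s => w s ^ (n + 1)) (((n : ℝ) + 1) * w s ^ n * deriv w s) s := by
      intro s _
      simpa using (hw.hasDerivAt s).fun_pow (n + 1)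
    have hlim : Tendsto (fun s => w s ^ (n + 1)) atTop (𝓝 0) := by
      simpa using hw.tendsto_zero.pow (n + 1)
    have hfr := hfi0.mono_set (Ioi_subset_Ioi hr'.le)
    have hgi : IntegrableOn (fun s => ((n : ℝ) + 1) * w s ^ n * deriv w s) (Ioi r) :=
      Integrable.mono' hfr (by fun_prop) (by simp [hf])
    have key := integral_Ioi_of_hasDerivAt_of_tendsto' hd hgi hlim
    have h3 : |w r ^ (n + 1)| ≤ ∫ s in Ioi r, f s := by
      have := abs_integral_le_integral_abs (μ := volume.restrict (Ioi r))
        (f := fun s => ((n : ℝ) + 1) * w s ^ n * deriv w s)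
      rwa [key, zero_sub, abs_neg] at this
    have h4 : w r ^ (2 * (n + 1)) = |w r ^ (n + 1)| ^ 2 := by
      rw [sq_abs, ← pow_mul, mul_comm 2]
    rw [h4]
    gcongr
  have hint : IntegrableOn (fun r => r * w r ^ (2 * (n + 1))) (Ioi 0) := by
    refine Integrable.mono' hki (by fun_prop) ?_
    filter_upwards [self_mem_ae_restrict measurableSet_Ioi] with r hr
    rw [Real.norm_of_nonneg (mul_nonneg (le_of_lt hr) (by rw [pow_mul]; positivity))]
    exact hpow r hr
  refine ⟨hint, (setIntegral_mono_on hint hki measurableSet_Ioi hpow).trans (hkle.trans ?_)⟩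
  refine pow_le_pow_left₀ (setIntegral_nonneg measurableSet_Ioi fun r hr =>
    mul_nonneg (le_of_lt hr) (hf0 r)) ?_ 2
  have := setIntegral_mono_on hfi hsum measurableSet_Ioi hbd
  rwa [integral_const_mul, integral_add hw.integrable_deriv hi] at this

lemma integral_gauge_nonneg (w : ℝ → ℝ) :
    0 ≤ ∫ r in Ioi 0, charge w r ^ 2 * w r ^ 2 / r :=
  setIntegral_nonneg measurableSet_Ioi fun _ hr =>
    div_nonneg (mul_nonneg (sq_nonneg _) (sq_nonneg _)) (le_of_lt hr)

lemma integral_deriv_eq (hp : 0 < p) (hw : IsRadialSolution p w) :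
    ∫ r in Ioi 0, r * deriv w r ^ 2
      = (p - 2) * ∫ r in Ioi 0, charge w r ^ 2 * w r ^ 2 / r := by
  linarith [hw.nehari hp, hw.pohozaev hp]

/-- All the integrals of even powers `w ^ k` with `k ≥ 4` are of order `∫ r w'²`, uniformly among the
solutions with `∫ r w'² ≤ 1`. -/
lemma exists_integral_pow_le (hp : 3 < p) (n : ℕ) :
    ∃ K : ℝ, 0 ≤ K ∧ ∀ w, IsRadialSolution p w → ∫ r in Ioi 0, r * deriv w r ^ 2 ≤ 1 →
      IntegrableOn (fun r => r * w r ^ (2 * (n + 2))) (Ioi 0) ∧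
      ∫ r in Ioi 0, r * w r ^ (2 * (n + 2)) ≤ K * ∫ r in Ioi 0, r * deriv w r ^ 2 := by
  induction n with
  | zero =>
    refine ⟨4, by norm_num, fun w hw _ => ⟨hw.integrable_four, ?_⟩⟩
    have h1 := hw.integral_four_le
    have h2 := hw.integral_deriv_eq (by linarith)
    have h3 := integral_gauge_nonneg w
    simp only [zero_add, Nat.reduceMul]
    nlinarith
  | succ n ih =>
    obtain ⟨K, hK, h⟩ := ih
    refine ⟨(((n : ℝ) + 3) / 2 * (1 + K)) ^ 2, by positivity, fun w hw h1 => ?_⟩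
    obtain ⟨hi, hle⟩ := h w hw h1
    obtain ⟨hi', hle'⟩ := hw.integral_pow_succ_le (n + 2) hi
    refine ⟨hi', hle'.trans ?_⟩
    set a := ∫ r in Ioi 0, r * deriv w r ^ 2
    have ha : 0 ≤ a := setIntegral_nonneg measurableSet_Ioi fun r hr =>
      mul_nonneg (le_of_lt hr) (sq_nonneg _)
    have hJ : 0 ≤ ∫ r in Ioi 0, r * w r ^ (2 * (n + 2)) :=
      setIntegral_nonneg measurableSet_Ioi fun r hr =>
        mul_nonneg (le_of_lt hr) (by rw [pow_mul]; positivity)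
    calc _ ≤ (((n : ℝ) + 3) / 2 * ((1 + K) * a)) ^ 2 := by
          rw [show ((n + 2 : ℕ) : ℝ) + 1 = n + 3 by push_cast; ring]
          gcongr
          linarith
      _ = (((n : ℝ) + 3) / 2 * (1 + K)) ^ 2 * (a * a) := by ring
      _ ≤ (((n : ℝ) + 3) / 2 * (1 + K)) ^ 2 * a := by
          gcongr
          exact mul_le_of_le_one_right ha h1

/-- The gauge terms of all nontrivial solutions have a common positive lower bound. If
`a = ∫ r w'² ≤ 1`, then `a ≤ ∫ r |w| ^ (p + 1) ≤ a / 2 + C a²`, with `C` depending on `p` only. -/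
lemma exists_lower_bound (hp : 3 < p) :
    ∃ ε : ℝ, 0 < ε ∧ ∀ w, IsRadialSolution p w →
      0 < ∫ r in Ioi 0, charge w r ^ 2 * w r ^ 2 / r →
      ε ≤ ∫ r in Ioi 0, charge w r ^ 2 * w r ^ 2 / r := by
  obtain ⟨n, hn⟩ := exists_nat_ge (p + 1)
  obtain ⟨K, hK, hpow⟩ := exists_integral_pow_le hp n
  obtain ⟨M, hM, hMle⟩ := exists_rpow_le (q := p + 1) (by linarith) (m := 2 * (n + 3))
    (by push_cast; linarith [Nat.cast_nonneg (α := ℝ) n])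
  set C : ℝ := M * (((n : ℝ) + 3) / 2 * (1 + K)) ^ 2 with hC
  have hC0 : 0 < C := by positivity
  refine ⟨min 1 (1 / (2 * C)) / (p - 2), div_pos (lt_min one_pos (by positivity)) (by linarith),
    fun w hw hb => ?_⟩
  have hab := hw.integral_deriv_eq (by linarith)
  have hbc := hw.pohozaev (by linarith)
  set a := ∫ r in Ioi 0, r * deriv w r ^ 2
  set b := ∫ r in Ioi 0, charge w r ^ 2 * w r ^ 2 / r
  have ha : 0 < a := by rw [hab]; exact mul_pos (by linarith) hb
  rw [div_le_iff₀ (by linarith), mul_comm b, ← hab]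
  rcases le_or_gt a 1 with h1 | h1
  swap
  · exact (min_le_left _ _).trans h1.le
  refine (min_le_right _ _).trans ?_
  obtain ⟨hi, hle⟩ := hpow w hw h1
  obtain ⟨hi', hle'⟩ := hw.integral_pow_succ_le (n + 2) hi
  have hJ : 0 ≤ ∫ r in Ioi 0, r * w r ^ (2 * (n + 2)) :=
    setIntegral_nonneg measurableSet_Ioi fun r hr =>
      mul_nonneg (le_of_lt hr) (by rw [pow_mul]; positivity)
  have hfour : ∫ r in Ioi 0, r * w r ^ 4 ≤ 4 * a := by
    have := hw.integral_four_le
    nlinarith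
  have hsq : ∫ r in Ioi 0, r * w r ^ (2 * (n + 3))
      ≤ (((n : ℝ) + 3) / 2 * (1 + K)) ^ 2 * a ^ 2 := by
    refine hle'.trans ?_
    rw [← mul_pow, mul_assoc, show ((n + 2 : ℕ) : ℝ) + 1 = n + 3 by push_cast; ring]
    gcongr
    linarith
  have hc : ∫ r in Ioi 0, r * |w r| ^ (p + 1)
      ≤ 1 / 8 * (∫ r in Ioi 0, r * w r ^ 4) + M * ∫ r in Ioi 0, r * w r ^ (2 * (n + 3)) := by
    rw [← integral_const_mul, ← integral_const_mul,
      ← integral_add (hw.integrable_four.const_mul _) (hi'.const_mul _)]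
    refine setIntegral_mono_on hw.integrable_rpow
      ((hw.integrable_four.const_mul _).add (hi'.const_mul _)) measurableSet_Ioi fun r hr => ?_
    have hr' : (0 : ℝ) < r := hr
    have h3 := mul_le_mul_of_nonneg_left (hMle |w r| (abs_nonneg _)) hr'.le
    rw [Even.pow_abs (by decide : Even 4), Even.pow_abs (even_two_mul (n + 3))] at h3
    linarith
  have hMsq := mul_le_mul_of_nonneg_left hsq hM.le
  have hac : a ≤ ∫ r in Ioi 0, r * |w r| ^ (p + 1) := by
    rw [← hbc, hab]
    exact mul_le_mul_of_nonneg_right (by linarith) hb.le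
  have hfin : a ≤ a / 2 + C * a ^ 2 := by
    rw [hC]
    linarith
  rw [div_le_iff₀ (by positivity)]
  by_contra hcon
  push Not at hcon
  nlinarith

end IsRadialSolution

/-! ### Calculus of radial functions on the plane -/

lemma norm_basisVec (j : Fin 2) : ‖basisVec j‖ = 1 := by simp [basisVec]

lemma norm_smul_basisVec (s : ℝ) (j : Fin 2) : ‖s • basisVec j‖ = |s| := by
  rw [norm_smul, norm_basisVec, mul_one, Real.norm_eq_abs]

lemma inner_basisVec (x : Plane) (j : Fin 2) : inner ℝ x (basisVec j) = x j := by
  rw [basisVec, EuclideanSpace.inner_single_right]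
  simp

lemma sq_add_sq_eq_norm_sq (x : Plane) : x 0 ^ 2 + x 1 ^ 2 = ‖x‖ ^ 2 := by
  rw [EuclideanSpace.norm_sq_eq, Fin.sum_univ_two]
  simp

lemma hasFDerivAt_norm_of_ne_zero {x : Plane} (hx : x ≠ 0) :
    HasFDerivAt (fun y : Plane => ‖y‖) (‖x‖⁻¹ • innerSL ℝ x) x := by
  have h := (hasStrictFDerivAt_norm_sq x).hasFDerivAt.sqrt (by positivity)
  simp only [Real.sqrt_sq (norm_nonneg _)] at h
  refine h.congr_fderiv ?_
  ext v
  simp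
  field_simp

lemma integrable_norm_iff {F : ℝ → ℝ} :
    Integrable (fun x : Plane => F ‖x‖) ↔ IntegrableOn (fun r => r * F r) (Ioi 0) := by
  rw [integrable_fun_norm_addHaar (volume : Measure Plane)]
  simp

/-- The length of the unit circle: twice the area of the unit disc. -/
noncomputable def circleLength : ℝ := 2 * (volume : Measure Plane).real (Metric.ball 0 1)

lemma circleLength_pos : 0 < circleLength :=
  mul_pos two_pos (ENNReal.toReal_pos (Metric.measure_ball_pos volume 0 one_pos).ne'
    measure_ball_lt_top.ne)

lemma integral_norm_eq (F : ℝ → ℝ) :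
    ∫ x : Plane, F ‖x‖ = circleLength * ∫ r in Ioi 0, r * F r := by
  rw [integral_fun_norm_addHaar (volume : Measure Plane), circleLength]
  simp [mul_assoc]

namespace IsRadial

variable {u : Plane → ℝ}

lemma eq_profile (hu : IsRadial u) (x : Plane) : u x = profile u ‖x‖ :=
  hu _ _ (by rw [norm_smul_basisVec, abs_norm])

lemma hasFDerivAt (hu : IsRadial u) (hc : ContDiff ℝ 2 (profile u)) {x : Plane} (hx : x ≠ 0) :
    HasFDerivAt u ((deriv (profile u) ‖x‖ * ‖x‖⁻¹) • innerSL ℝ x) x := by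
  have h := ((hc.differentiable (by norm_num) ‖x‖).hasDerivAt).comp_hasFDerivAt x
    (hasFDerivAt_norm_of_ne_zero hx)
  rw [smul_smul] at h
  exact h.congr_of_eventuallyEq (Eventually.of_forall hu.eq_profile)

lemma fderiv_apply (hu : IsRadial u) (hc : ContDiff ℝ 2 (profile u)) {x : Plane} (hx : x ≠ 0)
    (v : Plane) : fderiv ℝ u x v = deriv (profile u) ‖x‖ / ‖x‖ * inner ℝ x v := by
  rw [(hu.hasFDerivAt hc hx).fderiv]
  simp [div_eq_mul_inv]

lemma sq_fderiv_add_sq_fderiv (hu : IsRadial u) (hc : ContDiff ℝ 2 (profile u)) {x : Plane}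
    (hx : x ≠ 0) : fderiv ℝ u x (basisVec 0) ^ 2 + fderiv ℝ u x (basisVec 1) ^ 2
      = deriv (profile u) ‖x‖ ^ 2 := by
  rw [hu.fderiv_apply hc hx, hu.fderiv_apply hc hx, inner_basisVec, inner_basisVec, mul_pow,
    mul_pow, ← mul_add, sq_add_sq_eq_norm_sq, div_pow, div_mul_cancel₀]
  positivity

lemma norm_gradient_sq (hu : IsRadial u) (hc : ContDiff ℝ 2 (profile u)) {x : Plane}
    (hx : x ≠ 0) : ‖gradient u x‖ ^ 2 = deriv (profile u) ‖x‖ ^ 2 := by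
  rw [← sq_add_sq_eq_norm_sq, ← hu.sq_fderiv_add_sq_fderiv hc hx, ← inner_basisVec,
    ← inner_basisVec, inner_gradient_left, inner_gradient_left]

/-- The Laplacian in polar coordinates, at the points of the positive first half-axis. -/
lemma laplacian_eq (hu : IsRadial u) (hu2 : ContDiff ℝ 2 u) (hc : ContDiff ℝ 2 (profile u))
    {r : ℝ} (hr : 0 < r) : Laplacian.laplacian u (r • basisVec 0)
      = deriv (deriv (profile u)) r + deriv (profile u) r / r := by
  set w := profile u with hw
  set x : Plane := r • basisVec 0 with hx
  have hnx : ‖x‖ = r := by rw [hx, norm_smul_basisVec, abs_of_pos hr]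
  have hx0 : x ≠ 0 := norm_pos_iff.1 (hnx ▸ hr)
  have hw1 : ContDiff ℝ 1 (deriv w) := contDiff_one_deriv hc
  have hfd : Differentiable ℝ (fderiv ℝ u) :=
    (hu2.fderiv_right (m := 1) (by rw [one_add_one_eq_two])).differentiable (by norm_num)
  have hline (e : Plane) : HasDerivAt (fun t : ℝ => x + t • e) e 0 := by
    simpa using ((hasDerivAt_id (0 : ℝ)).smul_const e).const_add x
  -- A second derivative in the direction `e` is the derivative of `∂ₑ u` along a line.
  have hsecond (e : Plane) :
      HasDerivAt (fun t : ℝ => fderiv ℝ u (x + t • e) e) (fderiv ℝ (fderiv ℝ u) x e e) 0 := by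
    have h1 : HasFDerivAt (fderiv ℝ u) (fderiv ℝ (fderiv ℝ u) x) (x + (0 : ℝ) • e) := by
      simpa using (hfd x).hasFDerivAt
    have h2 := h1.comp_hasDerivAt (0 : ℝ) (hline e)
    simpa using h2.clm_apply (hasDerivAt_const (0 : ℝ) e)
  have hne (e : Plane) : ∀ᶠ t : ℝ in 𝓝 0, x + t • e ≠ 0 := by
    have h1 : ContinuousAt (fun t : ℝ => x + t • e) 0 := (hline e).continuousAt
    exact h1.eventually_ne (by simpa using hx0)
  have hd0 : fderiv ℝ (fderiv ℝ u) x (basisVec 0) (basisVec 0) = deriv (deriv w) r := by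
    have h1 : HasDerivAt (fun t : ℝ => deriv w (r + t)) (deriv (deriv w) r) 0 := by
      have h2 : HasDerivAt (deriv w) (deriv (deriv w) r) (r + 0) := by
        simpa using (hw1.differentiable (by norm_num) r).hasDerivAt
      exact h2.comp_const_add r 0
    refine (hsecond (basisVec 0)).unique (h1.congr_of_eventuallyEq ?_)
    filter_upwards [hne (basisVec 0), lt_mem_nhds (neg_lt_zero.2 hr)] with t ht ht'
    have h3 : x + t • basisVec 0 = (r + t) • basisVec 0 := by rw [hx, add_smul]
    have h4 : 0 < r + t := by linarith
    rw [hu.fderiv_apply hc ht, h3, norm_smul_basisVec, abs_of_pos h4, inner_basisVec]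
    simp [basisVec, h4.ne']
    rfl
  have hd1 : fderiv ℝ (fderiv ℝ u) x (basisVec 1) (basisVec 1) = deriv w r / r := by
    set φ : ℝ → ℝ := fun t => deriv w ‖x + t • basisVec 1‖ / ‖x + t • basisVec 1‖ with hφ
    have hnd : DifferentiableAt ℝ (fun t : ℝ => ‖x + t • basisVec 1‖) 0 := by
      have h1 : HasFDerivAt (fun y : Plane => ‖y‖) (‖x‖⁻¹ • innerSL ℝ x)
          (x + (0 : ℝ) • basisVec 1) := by simpa using hasFDerivAt_norm_of_ne_zero hx0
      exact (h1.comp_hasDerivAt (0 : ℝ) (hline (basisVec 1))).differentiableAt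
    have hφd : DifferentiableAt ℝ φ 0 := by
      refine DifferentiableAt.div ?_ hnd (by simpa using hx0)
      exact (hw1.differentiable (by norm_num) _).comp (0 : ℝ) hnd
    have h1 := (hasDerivAt_id (0 : ℝ)).mul hφd.hasDerivAt
    have h2 : HasDerivAt (fun t => t * φ t) (deriv w r / r) 0 := by
      refine h1.congr_deriv ?_
      simp [hφ, hnx]
    refine (hsecond (basisVec 1)).unique (h2.congr_of_eventuallyEq ?_)
    filter_upwards [hne (basisVec 1)] with t ht
    rw [hu.fderiv_apply hc ht, inner_basisVec, hφ]
    simp only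
    rw [mul_comm t]
    congr 1
    simp [hx, basisVec]
  rw [InnerProductSpace.laplacian_eq_iteratedFDeriv_orthonormalBasis u
    (EuclideanSpace.basisFun (Fin 2) ℝ)]
  simp only [Fin.sum_univ_two, iteratedFDeriv_two_apply, EuclideanSpace.basisFun_apply]
  rw [← hd0, ← hd1]
  rfl

end IsRadial

/-! ### The weak gradient of a smooth function -/

/-- A limit in `Lᵖ` is a weak limit against continuous functions with compact support. -/
lemma tendsto_integral_mul_of_eLpNorm {q : ℝ≥0∞} (hq : 1 ≤ q) {ψ : Plane → ℝ} (hψ : Continuous ψ)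
    (hψc : HasCompactSupport ψ) {F : ℕ → Plane → ℝ} {g : Plane → ℝ} (hF : ∀ n, Continuous (F n))
    (hg : MemLp g q volume)
    (hlim : Tendsto (fun n => eLpNorm (fun x => F n x - g x) q volume) atTop (𝓝 0)) :
    Tendsto (fun n => ∫ x, ψ x * F n x) atTop (𝓝 (∫ x, ψ x * g x)) := by
  have : Fact (1 ≤ q) := ⟨hq⟩
  have hψm : MemLp ψ (ENNReal.conjExponent q) volume := hψ.memLp_of_hasCompactSupport hψc
  have hT : ENNReal.HolderTriple (ENNReal.conjExponent q) q 1 :=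
    (inferInstance : q.HolderConjugate (ENNReal.conjExponent q)).symm
  refine tendsto_integral_of_L1' _ (hψ.aestronglyMeasurable.mul hg.1)
    (Eventually.of_forall fun n => ?_) ?_
  · exact (hψ.mul (hF n)).integrable_of_hasCompactSupport hψc.mul_right
  · have hub : Tendsto (fun n => eLpNorm ψ (ENNReal.conjExponent q) volume
        * eLpNorm (fun x => F n x - g x) q volume) atTop (𝓝 0) := by
      simpa using ENNReal.Tendsto.const_mul hlim (Or.inr hψm.2.ne)
    refine tendsto_of_tendsto_of_tendsto_of_le_of_le tendsto_const_nhds hub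
      (fun _ => zero_le) fun n => ?_
    have h := eLpNorm_smul_le_mul_eLpNorm (p := ENNReal.conjExponent q) (q := q) (r := 1)
      ((hF n).aestronglyMeasurable.sub hg.1) hψ.aestronglyMeasurable (μ := (volume : Measure Plane))
    refine le_trans (le_of_eq ?_) h
    congr 1
    ext x
    simp [mul_sub]

/-- Integration by parts shows that `G` is a weak gradient of `u`. -/
lemma IsLimitOfRadialTest.ae_eq_gradient {u : Plane → ℝ} {G : Plane → Plane}
    (h : IsLimitOfRadialTest u G) (hu : ContDiff ℝ 2 u) : G =ᵐ[volume] gradient u := by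
  obtain ⟨hu4, hG, f, hf, hfu, hfG⟩ := h
  have hu1 : Differentiable ℝ u := hu.differentiable (by norm_num)
  have hGj (e : Plane) (he : ‖e‖ = 1) : MemLp (fun x => inner ℝ (G x) e) 2 volume := by
    refine MemLp.mono hG (hG.1.inner_const) (Eventually.of_forall fun x => ?_)
    simpa [he] using norm_inner_le_norm (𝕜 := ℝ) (G x) e
  have hpart (ψ v : Plane → ℝ) (hψ : ContDiff ℝ ∞ ψ) (hψc : HasCompactSupport ψ)
      (hv : ContDiff ℝ 2 v) (e : Plane) :
      ∫ x, ψ x * fderiv ℝ v x e = -∫ x, fderiv ℝ ψ x e * v x := by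
    have hψ' : Continuous fun x => fderiv ℝ ψ x e :=
      (hψ.continuous_fderiv (by simp)).clm_apply continuous_const
    have hv' : Continuous fun x => fderiv ℝ v x e :=
      (hv.continuous_fderiv (by norm_num)).clm_apply continuous_const
    refine integral_mul_fderiv_eq_neg_fderiv_mul_of_integrable ?_ ?_ ?_ ?_ ?_
    · exact (hψ'.mul hv.continuous).integrable_of_hasCompactSupport
        (hψc.fderiv_apply (𝕜 := ℝ) e).mul_right
    · exact (hψ.continuous.mul hv').integrable_of_hasCompactSupport hψc.mul_right
    · exact (hψ.continuous.mul hv.continuous).integrable_of_hasCompactSupport hψc.mul_right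
    · exact fun x _ => hψ.differentiable (by simp) x
    · exact fun x _ => hv.differentiable (by norm_num) x
  have hcomp (e : Plane) (he : ‖e‖ = 1) :
      ∀ᵐ x, inner ℝ (G x) e = fderiv ℝ u x e := by
    have hu' : Continuous fun x => fderiv ℝ u x e :=
      (hu.continuous_fderiv (by norm_num)).clm_apply continuous_const
    refine ae_eq_of_integral_contDiff_smul_eq ((hGj e he).locallyIntegrable (by norm_num))
      hu'.locallyIntegrable fun ψ hψ hψc => ?_
    simp only [smul_eq_mul]
    have hf2 (n : ℕ) : ContDiff ℝ 2 (f n) := mod_cast contDiff_infty.1 (hf n).1 2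
    have hψ' : Continuous fun x => fderiv ℝ ψ x e :=
      (hψ.continuous_fderiv (by simp)).clm_apply continuous_const
    have hf' (n : ℕ) : Continuous fun x => fderiv ℝ (f n) x e :=
      ((hf2 n).continuous_fderiv (by norm_num)).clm_apply continuous_const
    have hlim' : Tendsto (fun n => eLpNorm (fun x => fderiv ℝ (f n) x e - inner ℝ (G x) e) 2
        volume) atTop (𝓝 0) := by
      refine tendsto_of_tendsto_of_tendsto_of_le_of_le tendsto_const_nhds hfG
        (fun _ => zero_le) fun n => eLpNorm_mono fun x => ?_
      rw [← inner_gradient_left, ← inner_sub_left]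
      simpa [he] using norm_inner_le_norm (𝕜 := ℝ) (gradient (f n) x - G x) e
    have t1 := tendsto_integral_mul_of_eLpNorm (by norm_num) hψ.continuous hψc hf' (hGj e he) hlim'
    have t2 := (tendsto_integral_mul_of_eLpNorm (by norm_num) hψ'
      (hψc.fderiv_apply (𝕜 := ℝ) e) (fun n => (hf2 n).continuous) hu4 hfu).neg
    rw [hpart ψ u hψ hψc hu e]
    refine tendsto_nhds_unique (t1.congr fun n => ?_) t2
    exact hpart ψ (f n) hψ hψc (hf2 n) e
  filter_upwards [hcomp _ (norm_basisVec 0), hcomp _ (norm_basisVec 1)] with x h0 h1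
  rw [← inner_gradient_left, inner_basisVec, inner_basisVec] at h0 h1
  ext j
  fin_cases j
  exacts [h0, h1]

/-! ### Classical solutions on the plane -/

lemma contDiff_profile {u : Plane → ℝ} (hu : ContDiff ℝ 2 u) : ContDiff ℝ 2 (profile u) :=
  hu.comp (contDiff_id.smul contDiff_const)

lemma hFun_eq_charge (u : Plane → ℝ) : hFun u = charge (profile u) := rfl

lemma V_eq_tailPotential (u : Plane → ℝ) (x : Plane) :
    V u x = tailPotential (profile u) ‖x‖ := rfl

lemma isLimitOfRadialTest_weakGrad {u : Plane → ℝ} (hu : u ∈ H24r) :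
    IsLimitOfRadialTest u (weakGrad u) := by
  have h := hu.2
  rw [weakGrad, dif_pos h]
  exact h.choose_spec

lemma ae_ne_zero : ∀ᵐ x : Plane, x ≠ 0 := by
  simp [ae_iff]

namespace S

variable {p : ℝ} {u : Plane → ℝ}

lemma weakGrad_sq_ae_eq (hu : u ∈ S p) :
    (fun x => ‖weakGrad u x‖ ^ 2) =ᵐ[volume] fun x => deriv (profile u) ‖x‖ ^ 2 := by
  obtain ⟨⟨h24, -⟩, -, hcl⟩ := hu
  filter_upwards [(isLimitOfRadialTest_weakGrad h24).ae_eq_gradient hcl.contDiff, ae_ne_zero]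
    with x hx hx0
  rw [hx, hcl.radial.norm_gradient_sq (contDiff_profile hcl.contDiff) hx0]

lemma gauge_eq (hu : u ∈ S p) :
    (fun x => hFun u ‖x‖ ^ 2 * u x ^ 2 / ‖x‖ ^ 2) = fun x =>
      charge (profile u) ‖x‖ ^ 2 * profile u ‖x‖ ^ 2 / ‖x‖ ^ 2 := by
  ext x
  rw [hu.2.2.radial.eq_profile x, hFun_eq_charge]

lemma rpow_eq (hu : u ∈ S p) :
    (fun x => |u x| ^ (p + 1)) = fun x => |profile u ‖x‖| ^ (p + 1) := by
  ext x
  rw [hu.2.2.radial.eq_profile x]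

lemma mul_div_sq_eq (w : ℝ → ℝ) : ∀ r ∈ Ioi (0 : ℝ),
    r * (charge w r ^ 2 * w r ^ 2 / r ^ 2) = charge w r ^ 2 * w r ^ 2 / r := by
  intro r hr
  have : r ≠ 0 := ne_of_gt hr
  field_simp

/-- The profile of a solution in `𝒮` satisfies the radial equation, and all the integrability
conditions pass to polar coordinates. -/
lemma isRadialSolution (hu : u ∈ S p) : IsRadialSolution p (profile u) := by
  obtain ⟨⟨h24, hE1, hE2, hE3⟩, -, hcl⟩ := id hu
  have hw := contDiff_profile hcl.contDiff
  refine ⟨hw, ?_, fun r hr => ?_, ?_, ?_, ?_, ?_, ?_⟩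
  · refine hcl.tendsto_zero.comp ?_
    rw [← Metric.cobounded_eq_cocompact, ← tendsto_norm_atTop_iff_cobounded]
    simp_rw [norm_smul_basisVec]
    exact tendsto_abs_atTop_atTop
  · have hn : ‖r • basisVec 0‖ = r := by rw [norm_smul_basisVec, abs_of_pos hr]
    have h0 : r • basisVec 0 ≠ 0 := norm_pos_iff.1 (hn.symm ▸ hr)
    have h := hcl.equation (r • basisVec 0)
    rw [hcl.radial.laplacian_eq hcl.contDiff hw hr, V_eq_tailPotential, U, if_neg h0, hn,
      hFun_eq_charge, hcl.radial.eq_profile, hn] at h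
    linarith
  · simpa [hFun_eq_charge] using hcl.integrable_V 0
  · exact integrable_norm_iff.1 (hE1.congr (weakGrad_sq_ae_eq hu))
  · rw [gauge_eq hu] at hE2
    exact (integrable_norm_iff.1 hE2).congr_fun (mul_div_sq_eq _) measurableSet_Ioi
  · rw [rpow_eq hu] at hE3
    exact integrable_norm_iff.1 hE3
  · have h4 : Integrable fun x => u x ^ 4 := by
      have h := (isLimitOfRadialTest_weakGrad h24).1.integrable_norm_rpow (by norm_num)
        (by norm_num)
      refine h.congr (Eventually.of_forall fun x => ?_)
      simp only [ENNReal.toReal_ofNat, Real.norm_eq_abs]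
      rw [show (4 : ℝ) = ((4 : ℕ) : ℝ) by norm_num, Real.rpow_natCast,
        Even.pow_abs (by decide : Even 4)]
    have he : (fun x => u x ^ 4) = fun x => profile u ‖x‖ ^ 4 := by
      ext x
      rw [hcl.radial.eq_profile x]
    rw [he] at h4
    exact integrable_norm_iff.1 h4

/-- By the Nehari and Pohozaev identities, the energy of a solution is a multiple of its gauge
term. -/
lemma energy_eq (hp : 3 < p) (hu : u ∈ S p) :
    E p u = circleLength * ((p - 3) / 2
      * ∫ r in Ioi 0, charge (profile u) r ^ 2 * profile u r ^ 2 / r) := by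
  have hw := isRadialSolution hu
  rw [E, integral_congr_ae (weakGrad_sq_ae_eq hu), gauge_eq hu, rpow_eq hu,
    integral_norm_eq (fun r => deriv (profile u) r ^ 2),
    integral_norm_eq (fun r => charge (profile u) r ^ 2 * profile u r ^ 2 / r ^ 2),
    integral_norm_eq (fun r => |profile u r| ^ (p + 1)),
    setIntegral_congr_fun measurableSet_Ioi (mul_div_sq_eq _), hw.integral_deriv_eq (by linarith),
    ← hw.pohozaev (by linarith)]
  have hp1 : p + 1 ≠ 0 := by linarith
  field_simp
  ring

lemma gauge_pos (hp : 3 < p) (hu : u ∈ S p) :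
    0 < ∫ r in Ioi 0, charge (profile u) r ^ 2 * profile u r ^ 2 / r := by
  refine (IsRadialSolution.integral_gauge_nonneg _).lt_of_ne fun h0 => hu.2.1 ?_
  -- By the Pohozaev identity, `∫ |u| ^ (p + 1)` vanishes if the gauge term does.
  have hpo := (isRadialSolution hu).pohozaev (by linarith)
  rw [← h0, mul_zero] at hpo
  have hint : ∫ x, |u x| ^ (p + 1) = 0 := by
    rw [rpow_eq hu, integral_norm_eq (fun r => |profile u r| ^ (p + 1)), ← hpo, mul_zero]
  rw [integral_eq_zero_iff_of_nonneg (fun x => by positivity) hu.1.2.2.2] at hint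
  have hc : Continuous fun x => |u x| ^ (p + 1) :=
    hu.2.2.contDiff.continuous.abs.rpow_const fun _ => Or.inr (by linarith)
  have hz := (Continuous.ae_eq_iff_eq volume hc continuous_zero).1 hint
  ext x
  have hx := congrFun hz x
  simpa using (Real.rpow_eq_zero (abs_nonneg _) (by linarith)).1 hx

/-- Since `u` and the `A_j` are real, `∂_j u` and `i A_j u` are orthogonal, and
`A₁² + A₂² = h_u² / |x|²`. -/
lemma covariant_sq_ae_eq (hu : u ∈ S p) (t : ℝ) :
    (fun x => ‖(staticFields u).D₁ t x‖ ^ 2 + ‖(staticFields u).D₂ t x‖ ^ 2) =ᵐ[volume]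
      fun x => ‖weakGrad u x‖ ^ 2 + hFun u ‖x‖ ^ 2 * u x ^ 2 / ‖x‖ ^ 2 := by
  have hcl := hu.2.2
  filter_upwards [weakGrad_sq_ae_eq hu, ae_ne_zero] with x hx hx0
  have hd : HasFDerivAt (fun y => (u y : ℂ)) (Complex.ofRealCLM.comp (fderiv ℝ u x)) x :=
    Complex.ofRealCLM.hasFDerivAt.comp x
      (hcl.contDiff.differentiable (by norm_num) x).hasFDerivAt
  have hsq (a b c : ℝ) : ‖(a : ℂ) + Complex.I * b * c‖ ^ 2 = a ^ 2 + (b * c) ^ 2 := by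
    rw [← Complex.normSq_eq_norm_sq, Complex.normSq_apply]
    simp
    ring
  have h1 : (staticFields u).D₁ t x = (fderiv ℝ u x (basisVec 0) : ℂ)
      + Complex.I * ((-(x 1 / ‖x‖ ^ 2 * hFun u ‖x‖) : ℝ) : ℂ) * (u x : ℂ) := by
    simp only [Fields.D₁, staticFields]
    rw [hd.fderiv]
    rfl
  have h2 : (staticFields u).D₂ t x = (fderiv ℝ u x (basisVec 1) : ℂ)
      + Complex.I * ((x 0 / ‖x‖ ^ 2 * hFun u ‖x‖ : ℝ) : ℂ) * (u x : ℂ) := by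
    simp only [Fields.D₂, staticFields]
    rw [hd.fderiv]
    rfl
  have hn : ‖x‖ ≠ 0 := norm_ne_zero_iff.2 hx0
  have hA : (-(x 1 / ‖x‖ ^ 2 * hFun u ‖x‖) * u x) ^ 2 + (x 0 / ‖x‖ ^ 2 * hFun u ‖x‖ * u x) ^ 2
      = hFun u ‖x‖ ^ 2 * u x ^ 2 / ‖x‖ ^ 2 := by
    have e : (-(x 1 / ‖x‖ ^ 2 * hFun u ‖x‖) * u x) ^ 2 + (x 0 / ‖x‖ ^ 2 * hFun u ‖x‖ * u x) ^ 2
        = (x 0 ^ 2 + x 1 ^ 2) * (hFun u ‖x‖ ^ 2 * u x ^ 2) / ‖x‖ ^ 4 := by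
      field_simp
      ring
    rw [e, sq_add_sq_eq_norm_sq]
    field_simp
  rw [h1, h2, hsq, hsq, hx, ← hcl.radial.sq_fderiv_add_sq_fderiv
    (contDiff_profile hcl.contDiff) hx0, ← hA]
  ring

lemma norm_rpow_eq (u : Plane → ℝ) (p t : ℝ) :
    (fun x => ‖(staticFields u).φ t x‖ ^ (p + 1)) = fun x => |u x| ^ (p + 1) := by
  ext x
  simp [staticFields]

lemma hasFiniteEnergy (hu : u ∈ S p) (t : ℝ) : (staticFields u).HasFiniteEnergy p t := by
  obtain ⟨⟨-, hE1, hE2, hE3⟩, -, -⟩ := id hu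
  refine ⟨(hE1.add hE2).congr (covariant_sq_ae_eq hu t).symm, ?_⟩
  rw [norm_rpow_eq]
  exact hE3

/-- The energy of the static quadruplet is `E(u)`, and so does not depend on time. -/
lemma staticFields_energy_eq (hu : u ∈ S p) (t : ℝ) : (staticFields u).energy p t = E p u := by
  obtain ⟨⟨-, hE1, hE2, -⟩, -, -⟩ := id hu
  rw [Fields.energy, E, integral_congr_ae (covariant_sq_ae_eq hu t), norm_rpow_eq,
    integral_add hE1 hE2]
  ring

lemma exists_energy_ge (hp : 3 < p) : ∃ ε : ℝ, 0 < ε ∧ ∀ u ∈ S p, ε ≤ E p u := by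
  obtain ⟨ε, hε, h⟩ := IsRadialSolution.exists_lower_bound hp
  have hκ := circleLength_pos
  have hp' : 0 < (p - 3) / 2 := by linarith
  refine ⟨circleLength * ((p - 3) / 2 * ε), by positivity, fun u hu => ?_⟩
  rw [energy_eq hp hu]
  have := h _ (isRadialSolution hu) (gauge_pos hp hu)
  gcongr

end S

end CSS

theorem proposition4p3 (p : ℝ) (hp : 3 < p) :
    (∀ u ∈ CSS.S p, ∀ t : ℝ,
      (CSS.staticFields u).HasFiniteEnergy p t ∧ 0 < (CSS.staticFields u).energy p t) ∧
    0 < ⨅ u ∈ CSS.S p, ((CSS.E p u : ℝ) : EReal) := by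
  obtain ⟨ε, hε, h⟩ := CSS.S.exists_energy_ge hp
  refine ⟨fun u hu t => ⟨CSS.S.hasFiniteEnergy hu t, ?_⟩, ?_⟩
  · rw [CSS.S.staticFields_energy_eq hu t]
    exact hε.trans_le (h u hu)
  · refine lt_of_lt_of_le (EReal.coe_pos.2 hε) (le_iInf₂ fun u hu => ?_)
    exact EReal.coe_le_coe_iff.2 (h u hu)
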